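/- Let $\sigma:\mathbb{R}^n\to[0,\infty)$ be an anisotropy, i.e. a convex, positively one-homogeneous function with $\sigma(p)>0$ for $p\neq 0$ (neither evenness nor differentiability is assumed). Put $F_\sigma=\{p\in\mathbb{R}^n : \sigma(p)\le 1\}$ and $\sigma^\circ(x)=\sup\{x\cdot p : p\in F_\sigma\}$. Let $\mathbb{T}^n=\mathbb{R}^n/\mathbb{Z}^n$ and let $H=L^2(\mathbb{T}^n)$ be the real Hilbert space with inner product $(u,v)=\int_{\mathbb{T}^n}uv\,dx$. Define the anisotropic total variation energy $\mathcal{E}:H\to[0,+\infty]$ (that is, $\int_{\mathbb{T}^n}\sigma(\nabla u)$ for $u\in BV(\mathbb{T}^n)\cap L^2(\mathbb{T}^n)$, and $+\infty$ otherwise) by $$\mathcal{E}(u)=\sup\Big\{-\int_{\mathbb{T}^n}u\,\operatorname{div}z\,dx \;:\; z\in C^1(\mathbb{T}^n;\mathbb{R}^n),\ \sigma^\circ(z)\le 1 \text{ on } \mathbb{T}^n\Big\},$$ its polar by $$\mathcal{E}^\circ(v)=\sup\{(u,v) : u\in H,\ \mathcal{E}(u)\le 1\},\qquad v\in H,$$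 and $$\Psi(v)=\inf\big\{\|\sigma^\circ(z)\|_{L^\infty(\mathbb{T}^n)} : z\in L^\infty(\mathbb{T}^n;\mathbb{R}^n),\ v=-\operatorname{div}z \text{ in the sense of distributions}\big\},\qquad v\in H,$$ with $\inf\emptyset=+\infty$; here $v=-\operatorname{div}z$ means $\int_{\mathbb{T}^n}v\varphi\,dx=\int_{\mathbb{T}^n}z\cdot\nabla\varphi\,dx$ for all $\varphi\in C^\infty(\mathbb{T}^n)$. Then $\mathcal{E}^\circ=\Psi$, that is, $\mathcal{E}^\circ(v)=\Psi(v)$ in $[0,+\infty]$ for every $v\in L^2(\mathbb{T}^n)$. -/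

import Mathlib

open MeasureTheory
open scoped ENNReal ContDiff

noncomputable section

namespace PolarTV

/-- Euclidean space `ℝⁿ`. -/
abbrev Rn (n : ℕ) : Type := EuclideanSpace ℝ (Fin n)

/-- The flat torus `𝕋ⁿ = ℝⁿ / ℤⁿ`; its `volume` is the product of the unit-mass Lebesgue (Haar)
measures on the factors `ℝ / ℤ`. -/
abbrev Torus (n : ℕ) : Type := UnitAddTorus (Fin n)

/-- The real Hilbert space `H = L²(𝕋ⁿ)`, with inner product `(u, v) = ∫ u v dx`. -/
abbrev H (n : ℕ) : Type := Lp ℝ 2 (volume : Measure (Torus n))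

/-- The space `L^∞(𝕋ⁿ; ℝⁿ)` of bounded measurable vector fields (modulo null sets). -/
abbrev LInftyField (n : ℕ) : Type := Lp (Rn n) ∞ (volume : Measure (Torus n))

/-- An anisotropy on `ℝⁿ`: a convex, positively one-homogeneous function, positive outside the
origin. It need be neither even nor differentiable. (It vanishes at `0` by homogeneity.) -/
structure IsAnisotropy {n : ℕ} (σ : Rn n → ℝ) : Prop where
  convex : ConvexOn ℝ Set.univ σ
  homogeneous : ∀ (c : ℝ) (p : Rn n), 0 < c → σ (c • p) = c * σ p
  pos : ∀ p : Rn n, p ≠ 0 → 0 < σ p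

/-- The Frank diagram `F_σ = {p | σ p ≤ 1}`. -/
def frank {n : ℕ} (σ : Rn n → ℝ) : Set (Rn n) := {p | σ p ≤ 1}

/-- `σ°(x) = sup {x · p | p ∈ F_σ}`, the support function of the Frank diagram. For an anisotropy
`F_σ` is bounded and contains `0`, so that this is a genuine supremum of real numbers. -/
def support {n : ℕ} (σ : Rn n → ℝ) (x : Rn n) : ℝ :=
  sSup ((fun p : Rn n => inner ℝ x p) '' frank σ)

/-- The quotient map `ℝⁿ → 𝕋ⁿ`. -/
def proj {n : ℕ} (x : Rn n) : Torus n := fun i => (x i : UnitAddCircle)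

/-- A map on the torus is `C^k` iff its `ℤⁿ`-periodic lift to `ℝⁿ` is. -/
def TorusContDiff {n : ℕ} {F : Type*} [NormedAddCommGroup F] [NormedSpace ℝ F]
    (k : ℕ∞) (f : Torus n → F) : Prop :=
  ContDiff ℝ k (fun x : Rn n => f (proj x))

/-- The partial derivative `∂f/∂x_i` of a function on the torus. -/
def torusPartial {n : ℕ} (i : Fin n) (f : Torus n → ℝ) (t : Torus n) : ℝ :=
  deriv (fun s : ℝ => f (t + Pi.single i (s : UnitAddCircle))) 0

/-- The gradient of a function on the torus. -/
def torusGrad {n : ℕ} (f : Torus n → ℝ) (t : Torus n) : Rn n :=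
  WithLp.toLp 2 (fun i => torusPartial i f t)

/-- The (classical) divergence of a vector field on the torus. -/
def torusDiv {n : ℕ} (z : Torus n → Rn n) (t : Torus n) : ℝ :=
  ∑ i, torusPartial i (fun t' => z t' i) t

/-- The anisotropic total variation
`E(u) = sup {-∫ u div z | z ∈ C¹(𝕋ⁿ; ℝⁿ), σ°(z) ≤ 1}`, as a functional on `L²(𝕋ⁿ)`;
this is `∫ σ(∇u)` for `u` in `BV(𝕋ⁿ)` and `+∞` otherwise. -/
def anisoTV {n : ℕ} (σ : Rn n → ℝ) (u : H n) : EReal :=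
  sSup {a : EReal | ∃ z : Torus n → Rn n, TorusContDiff 1 z ∧ (∀ t, support σ (z t) ≤ 1) ∧
    a = ((-∫ t, u t * torusDiv z t : ℝ) : EReal)}

/-- The polar of a functional `Φ` on `L²(𝕋ⁿ)`: `Φ°(v) = sup {(u, v) | Φ(u) ≤ 1}`. -/
def polar {n : ℕ} (Φ : H n → EReal) (v : H n) : EReal :=
  sSup {a : EReal | ∃ u : H n, Φ u ≤ 1 ∧ a = ((inner ℝ u v : ℝ) : EReal)}

/-- `v = -div z` in the sense of distributions on the torus: `∫ v φ = ∫ z · ∇φ` for every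
`φ ∈ C^∞(𝕋ⁿ)`. -/
def EqNegDiv {n : ℕ} (v : H n) (z : LInftyField n) : Prop :=
  ∀ φ : Torus n → ℝ, TorusContDiff ⊤ φ →
    ∫ t, v t * φ t = ∫ t, inner ℝ (z t) (torusGrad φ t)

/-- `Ψ(v) = inf {‖σ°(z)‖_∞ | z ∈ L^∞(𝕋ⁿ; ℝⁿ), v = -div z}`, which is `+∞` if there is no
such `z`. -/
def Psi {n : ℕ} (σ : Rn n → ℝ) (v : H n) : EReal :=
  sInf {a : EReal | ∃ z : LInftyField n, EqNegDiv v z ∧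
    a = ((eLpNorm (fun t => support σ (z t)) ∞ (volume : Measure (Torus n)) : ℝ≥0∞) : EReal)}

end PolarTV

end

open MeasureTheory
open scoped ENNReal ContDiff

noncomputable section

namespace PolarTV

/-! ### Differentiation, integration by parts and convolution on the torus -/

section TorusCalculus

open Filter Topology

variable {n : ℕ} {F : Type*} [NormedAddCommGroup F] [NormedSpace ℝ F]

/-! Two inequalities, neither of which uses the structure theory of BV.

`polar_le_Psi`: let `v = -div z` with `σ°(z) ≤ c` a.e. and let `E(u) ≤ 1`. For a smooth kernel `ρ ≥
0` of mass at most `1/c`, the field `w = ρ * z` is `C¹`, satisfies `σ°(w) ≤ 1` by convexity, and has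
`-div w = ρ * v`. Testing `E(u)` with `w` bounds the `ρ`-integral of the correlation `r ↦ ∫ u(r + s)
v(s) ds` by 1 (`integral_mul_correlation_le_one`). The correlation is continuous because
translations act continuously on `L²`, so letting kernels of mass `1/c` concentrate at 0 gives `(u,
v) ≤ c`.

`Psi_le_polar`: let `c = E°(v)` be finite. Integration by parts bounds the energy of a smooth `φ` by
`∫ σ(∇φ)`, so scaling gives `∫ v φ ≤ c ∫ σ(∇φ)`. Thus `∫ v φ` is a linear functional of `∇φ`
dominated by the sublinear `N(w) = c ∫ σ(w)`. Hahn–Banach extends it to all `L²` fields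
(`exists_comp_eq_of_le_sublinear`), Riesz represents it by a field `z`, and testing on indicator
functions turns domination by `N` into `σ°(z) ≤ c` a.e. (`IsAnisotropy.exists_field_of_le`). The
sublinear form of Hahn–Banach is needed since `σ` need not be even. -/

instance : Measure.IsNegInvariant (volume : Measure (Torus n)) :=
  Measure.IsAddHaarMeasure.isNegInvariant_of_regular volume

theorem isOpenQuotientMap_proj : IsOpenQuotientMap (proj : Rn n → Torus n) :=
  (IsOpenQuotientMap.piMap fun _ => QuotientAddGroup.isOpenQuotientMap_mk).comp
    (EuclideanSpace.equiv (Fin n) ℝ).toHomeomorph.isOpenQuotientMap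

theorem proj_add (x y : Rn n) : proj (x + y) = proj x + proj y := by
  ext i; simp [proj]

theorem proj_sub (x y : Rn n) : proj (x - y) = proj x - proj y := by
  ext i; simp [proj]

theorem proj_smul_single (i : Fin n) (s : ℝ) :
    proj (s • EuclideanSpace.single i (1 : ℝ)) = Pi.single i (s : UnitAddCircle) := by
  ext j
  by_cases h : j = i
  · subst h; simp [proj]
  · simp [proj, h]

theorem continuous_iff_comp_proj {X : Type*} [TopologicalSpace X] {f : Torus n → X} :
    Continuous f ↔ Continuous fun x : Rn n => f (proj x) :=
  isOpenQuotientMap_proj.isQuotientMap.continuous_iff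

theorem TorusContDiff.continuous {k : ℕ∞} {f : Torus n → F} (hf : TorusContDiff k f) :
    Continuous f :=
  continuous_iff_comp_proj.2 (ContDiff.continuous hf)

theorem TorusContDiff.of_le {k l : ℕ∞} {f : Torus n → F} (hf : TorusContDiff l f) (h : k ≤ l) :
    TorusContDiff k f :=
  ContDiff.of_le hf (by exact_mod_cast h)

/-- The Fréchet derivative of a function on the torus. -/
def torusFDeriv (f : Torus n → F) (t : Torus n) : Rn n →L[ℝ] F :=
  fderiv ℝ (fun y : Rn n => f (t + proj y)) 0

theorem torusFDeriv_proj (f : Torus n → F) (x : Rn n) :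
    torusFDeriv f (proj x) = fderiv ℝ (fun y : Rn n => f (proj y)) x := by
  have := fderiv_comp_add_left (𝕜 := ℝ) (f := fun y : Rn n => f (proj y)) (x := 0) x
  simpa [torusFDeriv, proj_add] using this

theorem TorusContDiff.differentiable {f : Torus n → F} (hf : TorusContDiff 1 f) :
    Differentiable ℝ fun x : Rn n => f (proj x) :=
  ContDiff.differentiable hf (by simp)

theorem TorusContDiff.continuous_torusFDeriv {f : Torus n → F} (hf : TorusContDiff 1 f) :
    Continuous (torusFDeriv f) := by
  rw [continuous_iff_comp_proj]
  simp_rw [torusFDeriv_proj]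
  exact ContDiff.continuous_fderiv hf (by simp)

theorem TorusContDiff.hasFDerivAt {f : Torus n → F} (hf : TorusContDiff 1 f) (t : Torus n)
    (x : Rn n) :
    HasFDerivAt (fun y : Rn n => f (t + proj y)) (torusFDeriv f (t + proj x)) x := by
  obtain ⟨a, rfl⟩ := isOpenQuotientMap_proj.surjective t
  simp_rw [← proj_add, torusFDeriv_proj]
  exact (hasFDerivAt_comp_add_left a).2 (hf.differentiable (a + x)).hasFDerivAt

theorem TorusContDiff.hasDerivAt {f : Torus n → F} (hf : TorusContDiff 1 f) (i : Fin n)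
    (t : Torus n) (s : ℝ) :
    HasDerivAt (fun s : ℝ => f (t + Pi.single i (s : UnitAddCircle)))
      (torusFDeriv f (t + Pi.single i (s : UnitAddCircle)) (EuclideanSpace.single i 1)) s := by
  have h := hf.hasFDerivAt t (s • EuclideanSpace.single i 1)
  have h2 : HasDerivAt (fun s : ℝ => s • (EuclideanSpace.single i 1 : Rn n))
      (EuclideanSpace.single i 1) s := by
    simpa using (hasDerivAt_id s).smul_const (EuclideanSpace.single i 1 : Rn n)
  simpa [Function.comp_def, proj_smul_single] using h.comp_hasDerivAt s h2

theorem TorusContDiff.torusPartial_eq {f : Torus n → ℝ} (hf : TorusContDiff 1 f) (i : Fin n)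
    (t : Torus n) : torusPartial i f t = torusFDeriv f t (EuclideanSpace.single i 1) := by
  rw [torusPartial, (hf.hasDerivAt i t 0).deriv]
  simp

theorem TorusContDiff.hasDerivAt_zero {f : Torus n → ℝ} (hf : TorusContDiff 1 f) (i : Fin n)
    (t : Torus n) :
    HasDerivAt (fun s : ℝ => f (t + Pi.single i (s : UnitAddCircle))) (torusPartial i f t) 0 := by
  simpa [hf.torusPartial_eq] using hf.hasDerivAt i t 0

theorem TorusContDiff.continuous_torusPartial {f : Torus n → ℝ} (hf : TorusContDiff 1 f)
    (i : Fin n) : Continuous (torusPartial i f) := by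
  simp_rw [funext (hf.torusPartial_eq i)]
  exact hf.continuous_torusFDeriv.clm_apply continuous_const

theorem TorusContDiff.continuous_torusGrad {f : Torus n → ℝ} (hf : TorusContDiff 1 f) :
    Continuous (torusGrad f) :=
  (PiLp.continuous_toLp 2 _).comp (continuous_pi fun i => hf.continuous_torusPartial i)

theorem TorusContDiff.apply {k : ℕ∞} {z : Torus n → Rn n} (hz : TorusContDiff k z) (i : Fin n) :
    TorusContDiff k fun t => z t i :=
  contDiff_euclidean.1 hz i

theorem TorusContDiff.mul {k : ℕ∞} {f g : Torus n → ℝ} (hf : TorusContDiff k f)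
    (hg : TorusContDiff k g) : TorusContDiff k fun t => f t * g t :=
  ContDiff.mul hf hg

theorem integrable_of_continuous {G : Type*} [NormedAddCommGroup G] {f : Torus n → G} (hf : Continuous f) : Integrable f :=
  hf.integrable_of_hasCompactSupport (HasCompactSupport.of_compactSpace f)

theorem exists_norm_le_of_continuous {G : Type*} [NormedAddCommGroup G] {f : Torus n → G} (hf : Continuous f) :
    ∃ C, ∀ t, ‖f t‖ ≤ C := by
  obtain ⟨C, hC⟩ := isCompact_univ.exists_bound_of_continuousOn hf.continuousOn
  exact ⟨C, fun t => hC t trivial⟩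

/-- By translation invariance the integral of `f(t + s eᵢ)` does not depend on `s`; differentiate
under the integral sign at `s = 0`. -/
theorem integral_torusPartial {f : Torus n → ℝ} (hf : TorusContDiff 1 f) (i : Fin n) :
    ∫ t, torusPartial i f t = 0 := by
  obtain ⟨C, hC⟩ := exists_norm_le_of_continuous
    (hf.continuous_torusFDeriv.clm_apply (continuous_const (y := EuclideanSpace.single i (1 : ℝ))))
  have hc := hf.continuous
  have key := hasDerivAt_integral_of_dominated_loc_of_deriv_le (μ := (volume : Measure (Torus n)))
    (F := fun (s : ℝ) t => f (t + Pi.single i (s : UnitAddCircle)))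
    (F' := fun (s : ℝ) t =>
      torusFDeriv f (t + Pi.single i (s : UnitAddCircle)) (EuclideanSpace.single i 1))
    (x₀ := 0) (s := Set.univ) (bound := fun _ => C) Filter.univ_mem
    (Eventually.of_forall fun s => Continuous.aestronglyMeasurable (by fun_prop))
    (integrable_of_continuous (by fun_prop))
    (Continuous.aestronglyMeasurable (by
      have := hf.continuous_torusFDeriv
      fun_prop))
    (Eventually.of_forall fun t s _ => hC _) (integrable_const _)
    (Eventually.of_forall fun t s _ => hf.hasDerivAt i t s)
  have h2 := key.2
  simp_rw [fun s : ℝ => integral_add_right_eq_self (μ := (volume : Measure (Torus n))) f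
    (Pi.single i (s : UnitAddCircle))] at h2
  have := h2.unique (hasDerivAt_const _ _)
  simpa [hf.torusPartial_eq] using this

theorem integral_mul_torusPartial {f g : Torus n → ℝ} (hf : TorusContDiff 1 f)
    (hg : TorusContDiff 1 g) (i : Fin n) :
    ∫ t, f t * torusPartial i g t = -∫ t, torusPartial i f t * g t := by
  have h : ∀ t, torusPartial i (fun t => f t * g t) t =
      torusPartial i f t * g t + f t * torusPartial i g t := fun t => by
    refine ((hf.hasDerivAt_zero i t).mul (hg.hasDerivAt_zero i t)).deriv.trans ?_
    simp
  have h0 := integral_torusPartial (hf.mul hg) i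
  simp_rw [h] at h0
  have h1 : ∫ t, torusPartial i f t * g t + f t * torusPartial i g t =
      (∫ t, torusPartial i f t * g t) + ∫ t, f t * torusPartial i g t := integral_add
    (integrable_of_continuous ((hf.continuous_torusPartial i).mul hg.continuous))
    (integrable_of_continuous (hf.continuous.mul (hg.continuous_torusPartial i)))
  linarith

/-- Integration by parts on the torus. -/
theorem integral_mul_torusDiv {f : Torus n → ℝ} {z : Torus n → Rn n} (hf : TorusContDiff 1 f)
    (hz : TorusContDiff 1 z) :
    -∫ t, f t * torusDiv z t = ∫ t, inner ℝ (z t) (torusGrad f t) := by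
  have hi := fun i => hz.apply i
  simp only [torusDiv, PiLp.inner_apply, torusGrad, Finset.mul_sum]
  have h : ∀ i, Integrable fun t => f t * torusPartial i (fun t' => z t' i) t := fun i =>
    integrable_of_continuous (hf.continuous.mul ((hi i).continuous_torusPartial i))
  rw [integral_finsetSum _ fun i _ => h i, integral_finsetSum, ← Finset.sum_neg_distrib]
  · refine Finset.sum_congr rfl fun i _ => ?_
    rw [integral_mul_torusPartial hf (hi i), neg_neg]
    rfl
  · intro i _
    exact integrable_of_continuous ((hi i).continuous.inner (hf.continuous_torusPartial i))

/-- Convolution of an integrable function with a `C¹` kernel is `C¹`. -/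
theorem TorusContDiff.convolution {ρ w : Torus n → ℝ} (hρ : TorusContDiff 1 ρ)
    (hw : Integrable w) : TorusContDiff 1 fun t => ∫ s, ρ (t - s) * w s := by
  obtain ⟨C, hC⟩ := exists_norm_le_of_continuous hρ.continuous
  obtain ⟨C', hC'⟩ := exists_norm_le_of_continuous hρ.continuous_torusFDeriv
  have hc := hρ.continuous
  have hc' := hρ.continuous_torusFDeriv
  have hm : ∀ t, AEStronglyMeasurable (fun s => w s • torusFDeriv ρ (t - s)) := fun t =>
    hw.aestronglyMeasurable.smul (Continuous.aestronglyMeasurable (by fun_prop))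
  have hb : ∀ t s, ‖w s • torusFDeriv ρ (t - s)‖ ≤ ‖w s‖ * C' := fun t s => by
    rw [norm_smul]; gcongr; exact hC' _
  have hd : ∀ x : Rn n, HasFDerivAt (fun x => ∫ s, ρ (proj x - s) * w s)
      (∫ s, w s • torusFDeriv ρ (proj x - s)) x := fun x =>
    (hasFDerivAt_integral_of_dominated_of_fderiv_le (μ := (volume : Measure (Torus n)))
      (F := fun (x : Rn n) s => ρ (proj x - s) * w s)
      (F' := fun (x : Rn n) s => w s • torusFDeriv ρ (proj x - s))
      (s := Set.univ) (bound := fun s => ‖w s‖ * C') Filter.univ_mem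
      (Eventually.of_forall fun x =>
        (Continuous.aestronglyMeasurable (by fun_prop)).mul hw.aestronglyMeasurable)
      (hw.bdd_mul (c := C) (Continuous.aestronglyMeasurable (by fun_prop))
        (Eventually.of_forall fun s => hC _))
      (hm _) (Eventually.of_forall fun s x _ => hb _ s) (hw.norm.mul_const _)
      (Eventually.of_forall fun s x _ => by
        have := hρ.hasFDerivAt (-s) x
        simp only [neg_add_eq_sub] at this
        exact this.mul_const (w s)))
  refine contDiff_one_iff_hasFDerivAt.2 ⟨_, ?_, hd⟩
  have : Continuous fun t => ∫ s, w s • torusFDeriv ρ (t - s) :=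
    continuous_of_dominated hm (fun t => Eventually.of_forall (hb t)) (hw.norm.mul_const _)
      (Eventually.of_forall fun s => by fun_prop)
  exact continuous_iff_comp_proj.1 this

theorem torusPartial_convolution {ρ w : Torus n → ℝ} (hρ : TorusContDiff 1 ρ)
    (hw : Integrable w) (i : Fin n) (t : Torus n) :
    torusPartial i (fun t => ∫ s, ρ (t - s) * w s) t = ∫ s, torusPartial i ρ (t - s) * w s := by
  obtain ⟨C, hC⟩ := exists_norm_le_of_continuous hρ.continuous
  obtain ⟨C', hC'⟩ := exists_norm_le_of_continuous
    (hρ.continuous_torusFDeriv.clm_apply (continuous_const (y := EuclideanSpace.single i (1 : ℝ))))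
  have hc := hρ.continuous
  have hc' := hρ.continuous_torusFDeriv
  have key := hasDerivAt_integral_of_dominated_loc_of_deriv_le (μ := (volume : Measure (Torus n)))
    (F := fun (r : ℝ) s => ρ (t + Pi.single i (r : UnitAddCircle) - s) * w s)
    (F' := fun (r : ℝ) s =>
      torusFDeriv ρ (t + Pi.single i (r : UnitAddCircle) - s) (EuclideanSpace.single i 1) * w s)
    (x₀ := 0) (s := Set.univ) (bound := fun s => C' * ‖w s‖) Filter.univ_mem
    (Eventually.of_forall fun s =>
      (Continuous.aestronglyMeasurable (by fun_prop)).mul hw.aestronglyMeasurable)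
    (hw.bdd_mul (c := C) (Continuous.aestronglyMeasurable (by fun_prop))
        (Eventually.of_forall fun s => hC _))
    ((Continuous.aestronglyMeasurable (by fun_prop)).mul hw.aestronglyMeasurable)
    (Eventually.of_forall fun s r _ => by
      rw [norm_mul]; gcongr; exact hC' _) (hw.norm.const_mul _)
    (Eventually.of_forall fun s r _ => by
      have := hρ.hasDerivAt i (t - s) r
      simp only [sub_add_eq_add_sub] at this
      exact this.mul_const (w s))
  rw [torusPartial, key.2.deriv]
  simp [hρ.torusPartial_eq]

theorem TorusContDiff.comp_sub_left {k : ℕ∞} {ρ : Torus n → F} (hρ : TorusContDiff k ρ)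
    (t : Torus n) : TorusContDiff k fun s => ρ (t - s) := by
  obtain ⟨a, rfl⟩ := isOpenQuotientMap_proj.surjective t
  simp only [TorusContDiff, ← proj_sub]
  exact ContDiff.comp (g := fun x : Rn n => ρ (proj x)) hρ (contDiff_const.sub contDiff_id)

theorem torusPartial_comp_sub_left {ρ : Torus n → ℝ} (hρ : TorusContDiff 1 ρ) (i : Fin n)
    (t s : Torus n) : torusPartial i (fun s => ρ (t - s)) s = -torusPartial i ρ (t - s) := by
  -- The base point is `-0` because the chain rule for `r ↦ -r` asks for the derivative at the image
  -- of `0`.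
  have h := hρ.hasDerivAt i (t - s) (-0)
  have := h.scomp (0 : ℝ) (hasDerivAt_neg (0 : ℝ))
  rw [torusPartial, hρ.torusPartial_eq]
  convert this.deriv using 1
  · congr 1
    ext r
    simp only [Function.comp_apply, AddCircle.coe_neg, Pi.single_neg]
    congr 1
    abel
  · simp

/-- The derivative falls on the kernel, and reflecting its argument costs a sign. The right side is
the distributional divergence of `z` tested with `ρ(t - ·)`. -/
theorem torusDiv_convolution {ρ : Torus n → ℝ} (hρ : TorusContDiff 1 ρ) {z : Torus n → Rn n}
    (hz : Integrable z) (t : Torus n) :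
    torusDiv (fun t => WithLp.toLp 2 fun i => ∫ s, ρ (t - s) * z s i) t =
      -∫ s, inner ℝ (z s) (torusGrad (fun s => ρ (t - s)) s) := by
  have hzi : ∀ i, Integrable fun s => z s i := fun i =>
    (EuclideanSpace.proj (𝕜 := ℝ) i).integrable_comp hz
  simp only [torusDiv, PiLp.inner_apply, torusGrad, torusPartial_convolution hρ (hzi _)]
  have hi : ∀ i, Integrable fun s => torusPartial i ρ (t - s) * z s i := fun i => by
    obtain ⟨C, hC⟩ := exists_norm_le_of_continuous (hρ.continuous_torusPartial i)
    have := hρ.continuous_torusPartial i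
    exact (hzi i).bdd_mul (c := C) (Continuous.aestronglyMeasurable (by fun_prop))
      (Eventually.of_forall fun s => hC _)
  simp only [torusPartial_comp_sub_left hρ, RCLike.inner_apply, conj_trivial, neg_mul,
    Finset.sum_neg_distrib, integral_neg, neg_neg]
  rw [integral_finsetSum _ fun i _ => hi i]

end TorusCalculus
-- Anisotropies and their support functions
section Anisotropy

variable {n : ℕ} {σ : Rn n → ℝ}

namespace IsAnisotropy

theorem map_zero (hσ : IsAnisotropy σ) : σ 0 = 0 := by
  have := hσ.homogeneous 2 0 two_pos
  rw [smul_zero] at this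
  linarith

theorem nonneg (hσ : IsAnisotropy σ) (p : Rn n) : 0 ≤ σ p := by
  rcases eq_or_ne p 0 with rfl | hp
  · exact hσ.map_zero.ge
  · exact (hσ.pos p hp).le

theorem add_le (hσ : IsAnisotropy σ) (p q : Rn n) : σ (p + q) ≤ σ p + σ q := by
  have h := hσ.convex.2 (Set.mem_univ p) (Set.mem_univ q) one_half_pos.le
    one_half_pos.le (add_halves 1)
  rw [← smul_add, hσ.homogeneous _ _ (by norm_num), smul_eq_mul, smul_eq_mul] at h
  linarith

theorem continuous (hσ : IsAnisotropy σ) : Continuous σ :=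
  hσ.convex.locallyLipschitz.continuous

theorem le_mul_norm (hσ : IsAnisotropy σ) : ∃ C, 0 ≤ C ∧ ∀ p, σ p ≤ C * ‖p‖ := by
  obtain ⟨C, hC⟩ := (isCompact_sphere (0 : Rn n) 1).exists_bound_of_continuousOn
    hσ.continuous.continuousOn
  refine ⟨max C 0, le_max_right _ _, fun p => ?_⟩
  rcases eq_or_ne p 0 with rfl | hp
  · simp [hσ.map_zero]
  have hn : 0 < ‖p‖ := norm_pos_iff.2 hp
  have h := (le_abs_self _).trans (hC (‖p‖⁻¹ • p) (by simp [norm_smul, hn.ne']))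
  rw [hσ.homogeneous _ _ (inv_pos.2 hn), inv_mul_le_iff₀ hn] at h
  rw [mul_comm]
  exact h.trans (by gcongr; exact le_max_left _ _)

/-- Compactness of the unit sphere and homogeneity. This bounds the Frank diagram, which makes the
supremum in `support` genuine. -/
theorem mul_norm_le (hσ : IsAnisotropy σ) : ∃ m, 0 < m ∧ ∀ p, m * ‖p‖ ≤ σ p := by
  obtain ⟨m, hm, h⟩ := (isCompact_sphere (0 : Rn n) 1).exists_forall_le' (a := 0)
    hσ.continuous.continuousOn fun p hp => hσ.pos p (ne_zero_of_mem_unit_sphere ⟨p, hp⟩)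
  refine ⟨m, hm, fun p => ?_⟩
  rcases eq_or_ne p 0 with rfl | hp
  · simp [hσ.map_zero]
  have hn : 0 < ‖p‖ := norm_pos_iff.2 hp
  have h := h (‖p‖⁻¹ • p) (by simp [norm_smul, hn.ne'])
  rwa [hσ.homogeneous _ _ (inv_pos.2 hn), le_inv_mul_iff₀ hn, mul_comm] at h

theorem zero_mem_frank (hσ : IsAnisotropy σ) : (0 : Rn n) ∈ frank σ := by
  simp [frank, hσ.map_zero]

theorem inner_le_support (hσ : IsAnisotropy σ) (x : Rn n) {p : Rn n} (hp : p ∈ frank σ) :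
    inner ℝ x p ≤ support σ x := by
  obtain ⟨m, hm, h⟩ := hσ.mul_norm_le
  refine le_csSup ⟨‖x‖ * m⁻¹, ?_⟩ ⟨p, hp, rfl⟩
  rintro _ ⟨q, hq, rfl⟩
  refine (real_inner_le_norm x q).trans ?_
  gcongr
  rw [← mul_one m⁻¹, le_inv_mul_iff₀ hm]
  exact (h q).trans hq

theorem support_nonneg (hσ : IsAnisotropy σ) (x : Rn n) : 0 ≤ support σ x := by
  simpa using hσ.inner_le_support x hσ.zero_mem_frank

theorem support_le (hσ : IsAnisotropy σ) {x : Rn n} {c : ℝ}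
    (h : ∀ p ∈ frank σ, inner ℝ x p ≤ c) : support σ x ≤ c :=
  csSup_le ⟨_, 0, hσ.zero_mem_frank, rfl⟩ (by rintro _ ⟨p, hp, rfl⟩; exact h p hp)

/-- The Cauchy–Schwarz inequality for an anisotropy and its support function. -/
theorem inner_le (hσ : IsAnisotropy σ) (x p : Rn n) : inner ℝ x p ≤ support σ x * σ p := by
  rcases eq_or_ne p 0 with rfl | hp
  · simp [hσ.map_zero]
  have hs := hσ.pos p hp
  have := hσ.inner_le_support x (p := (σ p)⁻¹ • p) (by
    simp [frank, hσ.homogeneous _ _ (inv_pos.2 hs), hs.ne'])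
  rwa [inner_smul_right, inv_mul_le_iff₀ hs, mul_comm] at this

theorem integrable_comp (hσ : IsAnisotropy σ) {α : Type*} [MeasurableSpace α] {μ : Measure α}
    {w : α → Rn n} (hw : Integrable w μ) : Integrable (fun t => σ (w t)) μ := by
  obtain ⟨C, hC0, hC⟩ := hσ.le_mul_norm
  refine (hw.norm.const_mul C).mono' (hσ.continuous.comp_aestronglyMeasurable hw.1)
    (Filter.Eventually.of_forall fun t => ?_)
  rw [Real.norm_of_nonneg (hσ.nonneg _)]
  exact hC _

end IsAnisotropy

end Anisotropy

/-! ### Hahn–Banach for a functional factoring through a linear map -/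

section HahnBanach

/-- A linear functional on `V` dominated by a sublinear function of a linear map `T : V → E`
factors through a dominated functional on `E`. -/
theorem exists_comp_eq_of_le_sublinear {V E : Type*} [AddCommGroup V] [Module ℝ V]
    [AddCommGroup E] [Module ℝ E] (T : V →ₗ[ℝ] E) (L : V →ₗ[ℝ] ℝ) (N : E → ℝ)
    (N_hom : ∀ c : ℝ, 0 < c → ∀ x, N (c • x) = c * N x)
    (N_add : ∀ x y, N (x + y) ≤ N x + N y) (hL : ∀ x, L x ≤ N (T x)) :
    ∃ g : E →ₗ[ℝ] ℝ, (∀ x, g (T x) = L x) ∧ ∀ y, g y ≤ N y := by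
  have N0 : N 0 = 0 := by
    have := N_hom 2 two_pos 0
    rw [smul_zero] at this
    linarith
  -- On the kernel of `T` both `L x` and `L (-x)` are at most `N 0 = 0`, so `L` descends to the
  -- range of `T`.
  have hker : L ∈ (LinearMap.ker T).dualAnnihilator := by
    rw [Submodule.mem_dualAnnihilator]
    intro x hx
    have h1 := hL x
    have h2 := hL (-x)
    rw [LinearMap.mem_ker] at hx
    rw [map_neg, map_neg, hx, neg_zero, N0] at h2
    rw [hx, N0] at h1
    linarith
  rw [← LinearMap.range_dualMap_eq_dualAnnihilator_ker] at hker
  obtain ⟨g₀, rfl⟩ := hker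
  obtain ⟨g, hg, hgN⟩ := exists_extension_of_le_sublinear
    ⟨LinearMap.range T, g₀.comp (LinearMap.range T).subtype⟩ N N_hom N_add
    (by rintro ⟨_, x, rfl⟩; exact hL x)
  exact ⟨g, fun x => hg ⟨T x, x, rfl⟩, hgN⟩

end HahnBanach

/-! ### Riesz representation of functionals dominated by `c ∫ σ` -/

section Representation

variable {n : ℕ} {σ : Rn n → ℝ}

/-- A linear functional on `L²` fields dominated by `w ↦ c ∫ σ(w)` is represented by a bounded
field `z` with `σ°(z) ≤ c`. -/
theorem IsAnisotropy.exists_field_of_le (hσ : IsAnisotropy σ) {c : ℝ} (hc : 0 ≤ c)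
    (g : Lp (Rn n) 2 (volume : Measure (Torus n)) →ₗ[ℝ] ℝ)
    (hg : ∀ w, g w ≤ c * ∫ t, σ (w t)) :
    ∃ z : LInftyField n, (∀ᵐ t, support σ (z t) ≤ c) ∧
      ∀ w, g w = ∫ t, inner ℝ (z t) (w t) := by
  obtain ⟨C, hC0, hC⟩ := hσ.le_mul_norm
  have hint : ∀ w : Lp (Rn n) 2 (volume : Measure (Torus n)), Integrable w := fun w =>
    (Lp.memLp w).integrable one_le_two
  -- The bound `σ ≤ C‖·‖` followed by Cauchy–Schwarz on a space of finite volume.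
  obtain ⟨M, hM⟩ : ∃ M : ℝ, ∀ w, g w ≤ M * ‖w‖ := by
    refine ⟨c * (C * (volume : Measure (Torus n)).real Set.univ ^ (1 / 2 : ℝ)), fun w => ?_⟩
    refine (hg w).trans ?_
    rw [mul_assoc]
    gcongr
    calc ∫ t, σ (w t) ≤ ∫ t, C * ‖w t‖ :=
          integral_mono (hσ.integrable_comp (hint w)) ((hint w).norm.const_mul C) fun t => hC _
      _ = C * ∫ t, ‖w t‖ := integral_const_mul _ _
      _ ≤ C * (volume : Measure (Torus n)).real Set.univ ^ (1 / 2 : ℝ) * ‖w‖ := by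
          rw [mul_assoc]
          gcongr
          have := eLpNorm_le_eLpNorm_mul_rpow_measure_univ (p := 1) (q := 2) one_le_two
            (Lp.aestronglyMeasurable w)
          rw [integral_norm_eq_lintegral_enorm (Lp.aestronglyMeasurable w),
            ← eLpNorm_one_eq_lintegral_enorm, Lp.norm_def, mul_comm, measureReal_def,
            ENNReal.toReal_rpow, ← ENNReal.toReal_mul]
          refine ENNReal.toReal_mono (ENNReal.mul_ne_top (Lp.eLpNorm_ne_top w) (by simp)) ?_
          convert this using 3
          norm_num
  let ℓ : StrongDual ℝ (Lp (Rn n) 2 (volume : Measure (Torus n))) :=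
    g.mkContinuous M fun w => by
      rw [Real.norm_eq_abs, abs_le]
      have := hM (-w)
      rw [map_neg, norm_neg] at this
      exact ⟨by linarith, hM w⟩
  let z := (InnerProductSpace.toDual ℝ (Lp (Rn n) 2 (volume : Measure (Torus n)))).symm ℓ
  have hz : ∀ w, inner ℝ z w = g w := fun w => InnerProductSpace.toDual_symm_apply
  -- Test with `p` times the indicator of `s`: since `σ 0 = 0`, the dominating integral is `c σ(p)`
  -- times the measure of `s`.
  have h1 : ∀ p : Rn n, ∀ᵐ t, inner ℝ (z t) p ≤ c * σ p := fun p => by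
    refine ae_le_of_forall_setIntegral_le ((hint z).inner_const p) (integrable_const _) ?_
    intro s hs hμ
    have h := hg (indicatorConstLp 2 hs hμ.ne p)
    rw [← hz, real_inner_comm, L2.inner_indicatorConstLp_eq_inner_setIntegral,
      ← integral_inner (hint z).integrableOn] at h
    simp only [real_inner_comm] at h ⊢
    refine h.trans_eq ?_
    rw [integral_const_mul]
    congr 1
    rw [← integral_indicator hs]
    refine integral_congr_ae ?_
    filter_upwards [indicatorConstLp_coeFn (p := 2) (hs := hs) (hμs := hμ.ne) (c := p)] with t ht
    rw [ht]
    by_cases h : t ∈ s <;> simp [h, hσ.map_zero]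
  -- The null set depends on `p`; a countable dense set of `p` and continuity give a common one.
  have h2 : ∀ᵐ t, ∀ p : Rn n, inner ℝ (z t) p ≤ c * σ p := by
    filter_upwards [ae_all_iff.2 fun k => h1 (TopologicalSpace.denseSeq (Rn n) k)] with t ht p
    have hcl : IsClosed {p : Rn n | inner ℝ (z t) p ≤ c * σ p} :=
      isClosed_le (by fun_prop) (continuous_const.mul hσ.continuous)
    refine hcl.closure_subset_iff.2 ?_ (TopologicalSpace.denseRange_denseSeq (Rn n) p)
    rintro _ ⟨k, rfl⟩
    exact ht k
  -- Taking `p = z t` gives `‖z t‖² ≤ c C ‖z t‖`.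
  have h3 : MemLp z ∞ := by
    refine memLp_top_of_bound (Lp.aestronglyMeasurable z) (c * C) ?_
    filter_upwards [h2] with t ht
    have := (ht (z t)).trans (mul_le_mul_of_nonneg_left (hC (z t)) hc)
    rw [real_inner_self_eq_norm_mul_norm, ← mul_assoc] at this
    rcases (norm_nonneg (z t)).eq_or_lt with h0 | h0
    · rw [← h0]; positivity
    · exact le_of_mul_le_mul_right this h0
  refine ⟨h3.toLp z, ?_, fun w => ?_⟩
  · filter_upwards [h2, h3.coeFn_toLp] with t ht hzt
    rw [hzt]
    exact hσ.support_le fun p hp => (ht p).trans (mul_le_of_le_one_right hc hp)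
  · rw [← hz, L2.inner_def]
    refine integral_congr_ae ?_
    filter_upwards [h3.coeFn_toLp] with t hzt
    rw [hzt]

end Representation
-- The inequality `Ψ ≤ E°`
section LowerBound

variable {n : ℕ} {σ : Rn n → ℝ}

theorem memLp_of_continuous {G : Type*} [NormedAddCommGroup G] {f : Torus n → G}
    (hf : Continuous f) (p : ℝ≥0∞) : MemLp f p :=
  (exists_norm_le_of_continuous hf).elim fun C hC =>
    MemLp.of_bound (integrable_of_continuous hf).aestronglyMeasurable C
      (Filter.Eventually.of_forall hC)

/-- The energy of a smooth function is at most `∫ σ(∇φ)`. -/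
theorem anisoTV_toLp_le (hσ : IsAnisotropy σ) {φ : Torus n → ℝ} (hφ : TorusContDiff 1 φ) :
    anisoTV σ ((memLp_of_continuous hφ.continuous 2).toLp φ) ≤
      ((∫ t, σ (torusGrad φ t) : ℝ) : EReal) := by
  refine sSup_le ?_
  rintro _ ⟨z, hz, hz1, rfl⟩
  rw [EReal.coe_le_coe_iff]
  have : ∫ t, (memLp_of_continuous hφ.continuous 2).toLp φ t * torusDiv z t =
      ∫ t, φ t * torusDiv z t := integral_congr_ae <| by
    filter_upwards [(memLp_of_continuous hφ.continuous 2).coeFn_toLp] with t ht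
    rw [ht]
  rw [this, integral_mul_torusDiv hφ hz]
  refine integral_mono (integrable_of_continuous (hz.continuous.inner hφ.continuous_torusGrad))
    (integrable_of_continuous (hσ.continuous.comp hφ.continuous_torusGrad)) fun t => ?_
  exact (hσ.inner_le _ _).trans (mul_le_of_le_one_left (hσ.nonneg _) (hz1 t))

theorem torusGrad_smul {φ : Torus n → ℝ} (hφ : TorusContDiff 1 φ) (c : ℝ) (t : Torus n) :
    torusGrad (c • φ) t = c • torusGrad φ t := by
  ext i
  exact ((hφ.hasDerivAt_zero i t).const_mul c).deriv

theorem torusGrad_add {φ ψ : Torus n → ℝ} (hφ : TorusContDiff 1 φ) (hψ : TorusContDiff 1 ψ)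
    (t : Torus n) : torusGrad (φ + ψ) t = torusGrad φ t + torusGrad ψ t := by
  ext i
  exact ((hφ.hasDerivAt_zero i t).add (hψ.hasDerivAt_zero i t)).deriv

theorem integral_mul_le_of_polar_le (hσ : IsAnisotropy σ) {v : H n} {c : ℝ}
    (h : polar (anisoTV σ) v ≤ c) {φ : Torus n → ℝ} (hφ : TorusContDiff 1 φ) :
    ∫ t, v t * φ t ≤ c * ∫ t, σ (torusGrad φ t) := by
  set I := ∫ t, σ (torusGrad φ t) with hI
  have hI0 : 0 ≤ I := integral_nonneg fun t => hσ.nonneg _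
  -- Normalising by `I` itself fails when `I = 0`; use every `s > I` and pass to the closure.
  have key : ∀ s, I < s → ∫ t, v t * φ t ≤ c * s := fun s hs => by
    have hs0 : 0 < s := hI0.trans_lt hs
    have hψ : TorusContDiff 1 (s⁻¹ • φ) := ContDiff.const_smul s⁻¹ hφ
    have hm := memLp_of_continuous hψ.continuous 2
    have hE : anisoTV σ (hm.toLp _) ≤ 1 := by
      refine (anisoTV_toLp_le hσ hψ).trans ?_
      simp_rw [torusGrad_smul hφ, hσ.homogeneous _ _ (inv_pos.2 hs0)]
      rw [integral_const_mul, ← hI, ← EReal.coe_one, EReal.coe_le_coe_iff, inv_mul_le_iff₀ hs0]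
      linarith
    have h1 := (le_sSup ⟨_, hE, rfl⟩ : _ ≤ polar (anisoTV σ) v).trans h
    rw [EReal.coe_le_coe_iff, L2.inner_def] at h1
    have h2 : ∫ t, inner ℝ (hm.toLp _ t) (v t) = ∫ t, s⁻¹ * (v t * φ t) := integral_congr_ae <| by
      filter_upwards [hm.coeFn_toLp] with t ht
      rw [ht]
      simp
      ring
    rw [h2, integral_const_mul, inv_mul_le_iff₀ hs0] at h1
    linarith
  have hcl : IsClosed {s | ∫ t, v t * φ t ≤ c * s} := isClosed_le continuous_const (by fun_prop)
  have : closure (Set.Ioi I) ⊆ {s | ∫ t, v t * φ t ≤ c * s} := hcl.closure_subset_iff.2 key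
  rw [closure_Ioi] at this
  exact this Set.self_mem_Ici

/-- The competitor `u = 0` has zero energy. In `EReal` this excludes the value `⊥`. -/
theorem polar_nonneg (v : H n) : 0 ≤ polar (anisoTV σ) v := by
  refine le_sSup ⟨0, sSup_le ?_, by simp⟩
  rintro _ ⟨z, -, -, rfl⟩
  simp

/-- The space of smooth functions on the torus. -/
def smoothFunctions (n : ℕ) : Submodule ℝ (Torus n → ℝ) where
  carrier := {φ | TorusContDiff ⊤ φ}
  add_mem' hφ hψ := by
    simp only [Set.mem_ofPred_eq, TorusContDiff] at *
    exact hφ.add hψ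
  zero_mem' := by
    simp only [Set.mem_ofPred_eq, TorusContDiff, Pi.zero_apply]
    exact contDiff_const
  smul_mem' c φ hφ := by
    simp only [Set.mem_ofPred_eq, TorusContDiff] at *
    exact hφ.const_smul c

theorem smoothFunctions.contDiff_one (φ : smoothFunctions n) : TorusContDiff 1 φ.1 :=
  TorusContDiff.of_le φ.2 le_top

/-- The gradient as a linear map from smooth functions to `L²` fields. -/
def gradLp (n : ℕ) : smoothFunctions n →ₗ[ℝ] Lp (Rn n) 2 (volume : Measure (Torus n)) where
  toFun φ := (memLp_of_continuous (smoothFunctions.contDiff_one φ).continuous_torusGrad 2).toLp _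
  map_add' φ ψ := by
    rw [← MemLp.toLp_add, MemLp.toLp_eq_toLp_iff]
    exact Filter.Eventually.of_forall fun t =>
      torusGrad_add (smoothFunctions.contDiff_one φ) (smoothFunctions.contDiff_one ψ) t
  map_smul' c φ := by
    rw [RingHom.id_apply, ← MemLp.toLp_const_smul, MemLp.toLp_eq_toLp_iff]
    exact Filter.Eventually.of_forall fun t => torusGrad_smul (smoothFunctions.contDiff_one φ) c t

theorem coeFn_gradLp (φ : smoothFunctions n) : gradLp n φ =ᵐ[volume] torusGrad φ.1 :=
  (memLp_of_continuous (smoothFunctions.contDiff_one φ).continuous_torusGrad 2).coeFn_toLp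

theorem integrable_mul_smooth (v : H n) (φ : smoothFunctions n) :
    Integrable fun t => v t * φ.1 t :=
  (Lp.memLp v).integrable_mul (memLp_of_continuous (smoothFunctions.contDiff_one φ).continuous 2)

/-- Pairing of smooth functions with an element of `L²`. -/
def smoothPairing (v : H n) : smoothFunctions n →ₗ[ℝ] ℝ where
  toFun φ := ∫ t, v t * φ.1 t
  map_add' φ ψ := by
    rw [← integral_add (integrable_mul_smooth v φ) (integrable_mul_smooth v ψ)]
    simp [mul_add]
  map_smul' c φ := by
    rw [RingHom.id_apply, smul_eq_mul, ← integral_const_mul]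
    simp [mul_left_comm]

theorem Psi_le_of_polar_le (hσ : IsAnisotropy σ) {v : H n} {c : ℝ} (hc : 0 ≤ c)
    (h : polar (anisoTV σ) v ≤ c) : Psi σ v ≤ c := by
  obtain ⟨g, hgL, hgN⟩ := exists_comp_eq_of_le_sublinear (gradLp n) (smoothPairing v)
    (fun w => c * ∫ t, σ (w t)) (fun r hr w => by
      beta_reduce
      rw [mul_left_comm, ← integral_const_mul r]
      congr 1
      refine integral_congr_ae ?_
      filter_upwards [Lp.coeFn_smul r w] with t ht
      rw [ht, Pi.smul_apply, hσ.homogeneous _ _ hr]) (fun w w' => by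
      have hw := hσ.integrable_comp ((Lp.memLp w).integrable one_le_two)
      have hw' := hσ.integrable_comp ((Lp.memLp w').integrable one_le_two)
      rw [← mul_add, ← integral_add hw hw']
      refine mul_le_mul_of_nonneg_left (integral_mono_ae
        (hσ.integrable_comp ((Lp.memLp (w + w')).integrable one_le_two)) (hw.add hw') ?_) hc
      filter_upwards [Lp.coeFn_add w w'] with t ht
      rw [ht]
      exact hσ.add_le _ _) (fun φ => by
      refine (integral_mul_le_of_polar_le hσ h (smoothFunctions.contDiff_one φ)).trans_eq ?_
      congr 1
      refine integral_congr_ae ?_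
      filter_upwards [coeFn_gradLp φ] with t ht
      rw [ht])
  obtain ⟨z, hz, hgz⟩ := hσ.exists_field_of_le hc g hgN
  have hdiv : EqNegDiv v z := fun φ hφ => by
    refine (hgL ⟨φ, hφ⟩).symm.trans ((hgz _).trans (integral_congr_ae ?_))
    filter_upwards [coeFn_gradLp ⟨φ, hφ⟩] with t ht
    rw [ht]
  have hbd : Psi σ v ≤ ((eLpNorm (fun t => support σ (z t)) ∞ volume : ℝ≥0∞) : EReal) :=
    sInf_le ⟨z, hdiv, rfl⟩
  refine hbd.trans ?_
  have : eLpNorm (fun t => support σ (z t)) ∞ volume ≤ ENNReal.ofReal c := by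
    refine eLpNormEssSup_le_of_ae_bound ?_
    filter_upwards [hz] with t ht
    rwa [Real.norm_of_nonneg (hσ.support_nonneg _)]
  refine (EReal.coe_ennreal_le_coe_ennreal_iff.2 this).trans_eq ?_
  rw [EReal.coe_ennreal_ofReal, max_eq_left hc]

theorem Psi_le_polar (hσ : IsAnisotropy σ) (v : H n) : Psi σ v ≤ polar (anisoTV σ) v := by
  have h0 := polar_nonneg (σ := σ) v
  induction h : polar (anisoTV σ) v with
  | bot => simp [h] at h0
  | top => exact le_top
  | coe c =>
    rw [h] at h0
    exact Psi_le_of_polar_le hσ (EReal.coe_nonneg.1 h0) h.le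

end LowerBound
-- The inequality `E° ≤ Ψ`
section UpperBound

open Filter Topology

variable {n : ℕ} {σ : Rn n → ℝ}

/-- The correlation of two functions in `L²` of the torus. -/
def correlation (u v : H n) (r : Torus n) : ℝ := ∫ s, u (r + s) * v s

theorem correlation_zero (u v : H n) : correlation u v 0 = inner ℝ u v := by
  simp [correlation, L2.inner_def, mul_comm]

/-- Seen as a pairing with a translate of `u`, the correlation inherits continuity from the
translation action on `L²`. -/
theorem correlation_eq_inner (u v : H n) (r : Torus n) :
    correlation u v r = inner ℝ (DomAddAct.mk r +ᵥ u) v := by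
  rw [L2.inner_def]
  refine integral_congr_ae ?_
  filter_upwards [DomAddAct.vadd_Lp_ae_eq (DomAddAct.mk r) u] with t ht
  rw [ht]
  exact mul_comm _ _

theorem continuous_correlation (u v : H n) : Continuous (correlation u v) := by
  have : Fact ((2 : ℝ≥0∞) ≠ ⊤) := ⟨by simp⟩
  have : ContinuousVAdd (Torus n)ᵈᵃᵃ (H n) := Lp.instContinuousVAddDomAddAct
  rw [funext (correlation_eq_inner u v)]
  refine Continuous.inner ?_ continuous_const
  exact DomAddAct.continuous_mk.vadd continuous_const

/-- Fubini, the substitution `t = r + s`, and Fubini again. This transfers the mollification of `v`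
to an average of the correlation. -/
theorem integral_mul_convolution {ρ : Torus n → ℝ} (hρ : Continuous ρ) (u v : H n) :
    ∫ t, u t * ∫ s, v s * ρ (t - s) = ∫ r, ρ r * correlation u v r := by
  obtain ⟨C, hC⟩ := exists_norm_le_of_continuous hρ
  have hu : Integrable u := (Lp.memLp u).integrable one_le_two
  have hv : Integrable v := (Lp.memLp v).integrable one_le_two
  have h1 : Integrable (Function.uncurry fun t s => u t * (v s * ρ (t - s)))
      (volume.prod volume) := by
    have : Integrable (fun p : Torus n × Torus n => ρ (p.1 - p.2) * (u p.1 * v p.2))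
        (volume.prod volume) :=
      (hu.mul_prod hv).bdd_mul (c := C) (Continuous.aestronglyMeasurable (by fun_prop))
        (Eventually.of_forall fun p => hC _)
    refine this.congr (Eventually.of_forall fun p => ?_)
    simp only [Function.uncurry]
    ring
  have h2 : Integrable (Function.uncurry fun s r => ρ r * (u (r + s) * v s))
      (volume.prod volume) := by
    -- The shear `(s, r) ↦ (s, s + r)` preserves the product measure.
    have hG := (measurePreserving_prod_add (volume : Measure (Torus n))
      (volume : Measure (Torus n))).integrable_comp_of_integrable (hv.mul_prod hu)
    have : Integrable (fun p : Torus n × Torus n => ρ p.2 * (v p.1 * u (p.1 + p.2)))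
        (volume.prod volume) :=
      Integrable.bdd_mul (c := C) hG (Continuous.aestronglyMeasurable (by fun_prop))
        (Eventually.of_forall fun p => hC _)
    refine this.congr (Eventually.of_forall fun p => ?_)
    simp only [Function.uncurry]
    rw [add_comm p.1, mul_comm (v _)]
  calc ∫ t, u t * ∫ s, v s * ρ (t - s) = ∫ t, ∫ s, u t * (v s * ρ (t - s)) := by
        simp_rw [integral_const_mul]
    _ = ∫ s, ∫ t, u t * (v s * ρ (t - s)) := integral_integral_swap h1
    _ = ∫ s, ∫ r, ρ r * (u (r + s) * v s) := by
        refine integral_congr_ae (Eventually.of_forall fun s => ?_)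
        dsimp only
        rw [← integral_add_right_eq_self _ s]
        refine integral_congr_ae (Eventually.of_forall fun r => ?_)
        dsimp only
        rw [add_sub_cancel_right]
        ring
    _ = ∫ r, ∫ s, ρ r * (u (r + s) * v s) := integral_integral_swap h2
    _ = ∫ r, ρ r * correlation u v r := by simp_rw [integral_const_mul, correlation]

theorem LInftyField.integrable (z : LInftyField n) : Integrable z :=
  (Lp.memLp z).integrable le_top

/-- Testing the energy with a mollification of a bounded field whose divergence is `-v`. -/
theorem integral_mul_correlation_le_one {u v : H n} (hu : anisoTV σ u ≤ 1)
    {z : LInftyField n} (hz : EqNegDiv v z) {c : ℝ} (hσ : IsAnisotropy σ)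
    (hzc : ∀ᵐ t, support σ (z t) ≤ c) {ρ : Torus n → ℝ} (hρ : TorusContDiff ⊤ ρ)
    (hρ0 : ∀ t, 0 ≤ ρ t) (hρc : c * ∫ t, ρ t ≤ 1) :
    ∫ r, ρ r * correlation u v r ≤ 1 := by
  have hρ1 : TorusContDiff 1 ρ := hρ.of_le le_top
  have hc := hρ.continuous
  have hzi := LInftyField.integrable z
  obtain ⟨C, hC⟩ := exists_norm_le_of_continuous hc
  set w : Torus n → Rn n := fun t => WithLp.toLp 2 fun i => ∫ s, ρ (t - s) * z s i with hw
  have hzi' : ∀ i, Integrable fun s => z s i := fun i =>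
    (EuclideanSpace.proj (𝕜 := ℝ) i).integrable_comp hzi
  have hw1 : TorusContDiff 1 w := contDiff_euclidean.2 fun i => hρ1.convolution (hzi' i)
  have hρz : ∀ t, Integrable fun s => ρ (t - s) • z s := fun t =>
    hzi.bdd_smul C (Continuous.aestronglyMeasurable (by fun_prop))
      (Eventually.of_forall fun s => hC _)
  have hw_eq : ∀ t, w t = ∫ s, ρ (t - s) • z s := fun t => by
    ext i
    exact (EuclideanSpace.proj (𝕜 := ℝ) i).integral_comp_comm (hρz t)
  -- Jensen in dual form: for `p` in the Frank diagram, `p · w(t)` integrates `p · z ≤ c` against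
  -- `ρ(t - ·)`, whose mass is that of `ρ`.
  have hw2 : ∀ t, support σ (w t) ≤ 1 := fun t => by
    refine hσ.support_le fun p hp => ?_
    rw [hw_eq, real_inner_comm, ← integral_inner (hρz t)]
    refine le_trans ?_ hρc
    rw [← integral_sub_left_eq_self ρ volume t, ← integral_const_mul]
    refine integral_mono_ae ((hρz t).const_inner p)
      ((integrable_of_continuous (by fun_prop : Continuous fun s => ρ (t - s))).const_mul c) ?_
    filter_upwards [hzc] with s hs
    rw [inner_smul_right, real_inner_comm, mul_comm]
    exact mul_le_mul_of_nonneg_right ((hσ.inner_le_support _ hp).trans hs) (hρ0 _)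
  have hle := (le_sSup ⟨w, hw1, hw2, rfl⟩ : _ ≤ anisoTV σ u).trans hu
  rw [← EReal.coe_one, EReal.coe_le_coe_iff] at hle
  rw [← integral_mul_convolution hc]
  refine le_of_eq_of_le ?_ hle
  rw [← integral_neg]
  refine integral_congr_ae (Eventually.of_forall fun t => ?_)
  dsimp only
  rw [torusDiv_convolution hρ1 hzi, ← hz _ (hρ.comp_sub_left t), mul_neg, neg_neg]

/-- A nonnegative smooth function on the torus with a unique maximum, at the origin. -/
def peak (t : Torus n) : ℝ := 1 + ∑ i, (1 + (AddCircle.toCircle (t i) : ℂ).re)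

theorem torusContDiff_peak : TorusContDiff ⊤ (peak (n := n)) := by
  simp only [TorusContDiff, peak, proj, AddCircle.toCircle_apply_mk, Circle.coe_exp,
    Complex.exp_ofReal_mul_I_re]
  fun_prop

theorem neg_one_le_re_circle (a : Circle) : -1 ≤ (a : ℂ).re :=
  neg_le_of_abs_le ((Complex.abs_re_le_norm a).trans_eq a.norm_coe)

theorem re_circle_le_one (a : Circle) : (a : ℂ).re ≤ 1 :=
  le_of_abs_le ((Complex.abs_re_le_norm a).trans_eq a.norm_coe)

theorem one_le_peak (t : Torus n) : 1 ≤ peak t :=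
  le_add_of_nonneg_right <| Finset.sum_nonneg fun i _ => by
    linarith [neg_one_le_re_circle (AddCircle.toCircle (t i))]

theorem peak_lt {t : Torus n} (ht : t ≠ 0) : peak t < peak (0 : Torus n) := by
  obtain ⟨i, hi⟩ := Function.ne_iff.1 ht
  have h0 : ∀ j, (AddCircle.toCircle ((0 : Torus n) j) : ℂ).re = 1 := fun j => by simp
  simp only [peak, h0]
  refine add_lt_add_right (Finset.sum_lt_sum (fun j _ => ?_) ⟨i, Finset.mem_univ i, ?_⟩) _
  · linarith [re_circle_le_one (AddCircle.toCircle (t j))]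
  · refine add_lt_add_right ((re_circle_le_one _).lt_of_ne fun h => hi ?_) _
    apply AddCircle.injective_toCircle one_ne_zero
    rw [Pi.zero_apply, AddCircle.toCircle_zero]
    -- A unit complex number with real part 1 has zero imaginary part.
    ext
    refine Complex.ext h ?_
    have := Complex.normSq_eq_norm_sq (AddCircle.toCircle (t i) : ℂ)
    rw [Complex.normSq_apply, h, Circle.norm_coe] at this
    simp only [Circle.coe_one, Complex.one_im]
    nlinarith

/-- Normalised powers of a positive function concentrate at its unique maximum, which yields an
explicit smooth approximate identity. -/
theorem tendsto_peak {g : Torus n → ℝ} (hg : Continuous g) :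
    Tendsto (fun k : ℕ => (∫ t : Torus n, peak t ^ k)⁻¹ * ∫ t, peak t ^ k * g t) atTop (𝓝 (g 0)) := by
  have := tendsto_setIntegral_pow_smul_of_unique_maximum_of_isCompact_of_continuousOn
    (μ := (volume : Measure (Torus n))) (x₀ := (0 : Torus n)) (g := g) isCompact_univ
    (torusContDiff_peak (n := n)).continuous.continuousOn (fun t _ ht => peak_lt ht)
    (fun t _ => zero_le_one.trans (one_le_peak t)) (zero_lt_one.trans_le (one_le_peak 0))
    (by simp) hg.continuousOn
  simpa using this

theorem inner_le_of_eqNegDiv (hσ : IsAnisotropy σ) {u v : H n} (hu : anisoTV σ u ≤ 1)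
    {z : LInftyField n} (hz : EqNegDiv v z) {c : ℝ} (hc : 0 < c)
    (hzc : ∀ᵐ t, support σ (z t) ≤ c) : inner ℝ u v ≤ c := by
  rw [← correlation_zero]
  refine le_of_tendsto (tendsto_peak (continuous_correlation u v))
    (Eventually.of_forall fun k => ?_)
  have hk : TorusContDiff ⊤ fun t : Torus n => peak t ^ k := ContDiff.pow torusContDiff_peak k
  have hk1 : ∀ t : Torus n, 1 ≤ peak t ^ k := fun t => one_le_pow₀ (one_le_peak t)
  have hI : 0 < ∫ t : Torus n, peak t ^ k :=
    hk.continuous.integral_pos_of_hasCompactSupport_nonneg_nonzero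
      (HasCompactSupport.of_compactSpace _) (fun t => zero_le_one.trans (hk1 t))
      (x := 0) (zero_lt_one.trans_le (hk1 0)).ne'
  -- The kernel is normalised to mass exactly `1/c`.
  have h := integral_mul_correlation_le_one hu hz hσ hzc
    (ρ := fun t => (c * ∫ t : Torus n, peak t ^ k)⁻¹ * peak t ^ k)
    (ContDiff.mul contDiff_const hk)
    (fun t => mul_nonneg (by positivity) (zero_le_one.trans (hk1 t)))
    (by rw [integral_const_mul]; field_simp; rfl)
  simp_rw [mul_assoc] at h
  rwa [integral_const_mul, mul_inv, mul_assoc, inv_mul_le_iff₀ hc, mul_one] at h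

theorem polar_le_Psi (hσ : IsAnisotropy σ) (v : H n) : polar (anisoTV σ) v ≤ Psi σ v := by
  refine sSup_le ?_
  rintro _ ⟨u, hu, rfl⟩
  refine le_sInf ?_
  rintro _ ⟨z, hz, rfl⟩
  set N := eLpNorm (fun t => support σ (z t)) ∞ (volume : Measure (Torus n)) with hN
  rcases eq_or_ne N ∞ with h | h
  · simp [h]
  rw [← ENNReal.ofReal_toReal h, EReal.coe_ennreal_ofReal, max_eq_left ENNReal.toReal_nonneg,
    EReal.coe_le_coe_iff]
  -- The essential supremum may be 0 while the kernel needs `c > 0`, so every larger `c` is used.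
  refine le_of_forall_gt_imp_ge_of_dense fun c hc => ?_
  refine inner_le_of_eqNegDiv hσ hu hz (ENNReal.toReal_nonneg.trans_lt hc) ?_
  filter_upwards [ae_le_eLpNormEssSup (f := fun t => support σ (z t))
    (μ := (volume : Measure (Torus n)))] with t ht
  rw [← eLpNorm_exponent_top, ← hN, ← ofReal_norm,
    Real.norm_of_nonneg (hσ.support_nonneg _), ENNReal.ofReal_le_iff_le_toReal h] at ht
  exact ht.trans hc.le

end UpperBound
end PolarTV

end

theorem mainTheorem1 {n : ℕ} (σ : PolarTV.Rn n → ℝ) (hσ : PolarTV.IsAnisotropy σ) :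
    ∀ v : PolarTV.H n, PolarTV.polar (PolarTV.anisoTV σ) v = PolarTV.Psi σ v :=
  fun v => le_antisymm (PolarTV.polar_le_Psi hσ v) (PolarTV.Psi_le_polar hσ v)
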